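/- Let $M$ be a smooth finite-dimensional manifold, $\mathrm{Diff}(M)$ its diffeomorphism group (with its functional smooth structure: smooth families $g_x$ are those for which $(x,m)\mapsto g_x(m)$ and $(x,m)\mapsto g_x^{-1}(m)$ are smooth) and $\mathfrak{diff}(M)=\Gamma(TM)$ its Lie algebra. Let $\Phi$ be a field space, i.e. a (diffeological, possibly infinite-dimensional) smooth space with a smooth right action $R_\psi\phi=\phi^\psi=\psi^*\phi$ of $\mathrm{Diff}(M)$; for $X\in\mathfrak{diff}(M)$, $X=\frac{d}{d\tau}\psi_\tau|_{\tau=0}$ with $\psi_0=\mathrm{id}$, let $X^v_{|\phi}=\frac{d}{d\tau}R_{\psi_\tau}\phi|_{\tau=0}$. For a subgroup $H\subset\mathrm{Diff}(M)$ with Lie algebra $\mathfrak h$ (the velocities at $\mathrm{id}$ of smooth families in $H$) and a representation $(\rho,V)$ of $\mathrm{Diff}(M)$, a smooth $V$-valued form $\alpha$ on $\Phi$ is $\rho$-tensorial for $H$ if $R_\psi^\star\alpha=\rho(\psi)^{-1}\alpha$ for $\psi\in H$ and $\iota_{X^v}\alpha=0$ for $X\in\mathfrak h$; it is $H$-basic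 if $R_\psi^\star\alpha=\alpha$ for $\psi\in H$ and $\iota_{X^v}\alpha=0$ for $X\in\mathfrak h$. An Ehresmann connection for $H$ is a smooth $\mathfrak{diff}(M)$-valued 1-form $\omega$ on $\Phi$ with $\omega(X^v)=X$ for $X\in\mathfrak h$ and $R_\psi^\star\omega=\psi^{-1}_*\,\omega\circ\psi$ for $\psi\in H$. Let $\mathrm{Diff}_0(M)\triangleleft\mathrm{Diff}(M)$ be a normal subgroup and let the residual group $\mathrm{Diff}_r(M)=\mathrm{Diff}(M)/\mathrm{Diff}_0(M)$ be realised as a subgroup of $\mathrm{Diff}(M)$ by a homomorphic section of the quotient map. Let $\boldsymbol u:\Phi\to\mathrm{Diff}(M)$ be a smooth map (a field-dependent dressing field with values in invertible elements of $\mathcal Dr[M,M]$) such that $$\boldsymbol u(\phi^{\varphi})=\varphi^{-1}\circ\boldsymbol u(\phi)\quad(\varphi\in\mathrm{Diff}_0(M)),\qquad \boldsymbol u(\phi^{\psi})=\psi^{-1}\circ\boldsymbol u(\phi)\circ\psi\quad(\psi\in\mathrm{Diff}_r(M)).$$ Let $F_{\boldsymbol u}(\phi)=\boldsymbol u(\phi)^*\phi$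 and, for a form $\alpha$ on $\Phi$, let $\alpha^{\boldsymbol u}=F_{\boldsymbol u}^\star\alpha$ be its dressing. For a smooth map $\boldsymbol\psi:\Phi\to\mathrm{Diff}_r(M)$ let $\alpha^{\boldsymbol\psi}=\Xi^\star\alpha$ with $\Xi(\phi)=\boldsymbol\psi(\phi)^*\phi$. 1. Let $\alpha$ be a $V$-valued $k$-form that is $\rho$-tensorial for $\mathrm{Diff}(M)$. Then $\alpha^{\boldsymbol u}=\rho(\boldsymbol u)^{-1}\alpha$; this form is $\mathrm{Diff}_0(M)$-basic, is annihilated by $\iota_{X^v}$ for all $X\in\mathfrak{diff}(M)$, and is $\rho$-tensorial for $\mathrm{Diff}_r(M)$; and for every smooth $\boldsymbol\psi:\Phi\to\mathrm{Diff}_r(M)$ $$(\alpha^{\boldsymbol u})^{\boldsymbol\psi}=\rho(\boldsymbol\psi^{-1})\,\alpha^{\boldsymbol u}.$$ 2. Let $\omega$ be an Ehresmann connection for $\mathrm{Diff}(M)$. Then $\omega^{\boldsymbol u}=\boldsymbol u^{-1}_*\,\omega\circ\boldsymbol u+\boldsymbol u^{-1}_*\boldsymbol{du}$; this form is $\mathrm{Diff}_0(M)$-basic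 and is an Ehresmann connection for $\mathrm{Diff}_r(M)$; and for every smooth $\boldsymbol\psi:\Phi\to\mathrm{Diff}_r(M)$ $$(\omega^{\boldsymbol u})^{\boldsymbol\psi}=\boldsymbol\psi^{-1}_*\,\omega^{\boldsymbol u}\circ\boldsymbol\psi+\boldsymbol\psi^{-1}_*\boldsymbol{d\psi}.$$ -/

import Mathlib

open scoped Manifold ContDiff RightActions
open Diffeology

noncomputable section

namespace FieldSpace

/-- The cartesian space `ℝⁿ`. -/
abbrev Eu (n : ℕ) : Type := EuclideanSpace ℝ (Fin n)

section Manifold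

variable (d : ℕ) (M : Type*) [TopologicalSpace M] [ChartedSpace (Eu d) M]

/-- The diffeomorphism group `Diff(M)` of a smooth `d`-dimensional manifold `M`. -/
abbrev Diff : Type _ := Diffeomorph (𝓡 d) (𝓡 d) M M ∞

variable {d M}

/-- The group law of `Diff(M)` is composition: `f * g = f ∘ g`. -/
instance instGroupDiff : Group (Diff d M) where
  mul f g := g.trans f
  one := Diffeomorph.refl (𝓡 d) M ∞
  inv f := f.symm
  mul_assoc _ _ _ := Diffeomorph.ext fun _ => rfl
  one_mul _ := Diffeomorph.ext fun _ => rfl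
  mul_one _ := Diffeomorph.ext fun _ => rfl
  inv_mul_cancel f := Diffeomorph.ext fun x => f.symm_apply_apply x

/-- Auxiliary: locality of smoothness for maps depending on a parameter in an open set. -/
theorem contMDiffOn_prod_univ_of_local {n : ℕ} {E' H' N : Type*} [NormedAddCommGroup E']
    [NormedSpace ℝ E'] [TopologicalSpace H'] {J : ModelWithCorners ℝ E' H'}
    [TopologicalSpace N] [ChartedSpace H' N] {u : Set (Eu n)} {F : Eu n × M → N}
    (h : ∀ x ∈ u, ∃ v : Set (Eu n), IsOpen v ∧ x ∈ v ∧
      ContMDiffOn (𝓘(ℝ, Eu n).prod (𝓡 d)) J ∞ F (v ×ˢ Set.univ)) :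
    ContMDiffOn (𝓘(ℝ, Eu n).prod (𝓡 d)) J ∞ F (u ×ˢ Set.univ) := by
  rintro ⟨x, m⟩ ⟨hx, -⟩
  obtain ⟨v, hv, hxv, hF⟩ := h x hx
  exact ((hF (x, m) ⟨hxv, trivial⟩).contMDiffAt
    ((hv.prod isOpen_univ).mem_nhds ⟨hxv, trivial⟩)).contMDiffWithinAt

/-- Auxiliary: reparametrisation of smooth maps depending on a parameter in an open set. -/
theorem contMDiffOn_prod_univ_reparam {n k : ℕ} {E' H' N : Type*} [NormedAddCommGroup E']
    [NormedSpace ℝ E'] [TopologicalSpace H'] {J : ModelWithCorners ℝ E' H'}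
    [TopologicalSpace N] [ChartedSpace H' N] {u : Set (Eu n)} {v : Set (Eu k)}
    {F : Eu n × M → N} {f : Eu k → Eu n} (hf : ContDiffOn ℝ ∞ f v) (hfu : Set.MapsTo f v u)
    (hF : ContMDiffOn (𝓘(ℝ, Eu n).prod (𝓡 d)) J ∞ F (u ×ˢ Set.univ)) :
    ContMDiffOn (𝓘(ℝ, Eu k).prod (𝓡 d)) J ∞ (fun z : Eu k × M => F (f z.1, z.2))
      (v ×ˢ Set.univ) := by
  refine hF.comp (t := u ×ˢ Set.univ) (ContMDiffOn.prodMk ?_ contMDiffOn_snd) ?_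
  · exact (contMDiffOn_iff_contDiffOn.2 hf).comp contMDiffOn_fst fun z hz => hz.1
  · exact fun z hz => ⟨hfu hz.1, trivial⟩

/-- The functional diffeology of `Diff(M)`: a family `g : ℝⁿ → Diff(M)` is smooth iff both
`(x, m) ↦ g x m` and `(x, m) ↦ (g x)⁻¹ m` are smooth. -/
instance instDiffeologyDiff : DiffeologicalSpace (Diff d M) :=
  .ofCorePlotsOn {
    isPlotOn := fun {n u} _ g =>
      ContMDiffOn (𝓘(ℝ, Eu n).prod (𝓡 d)) (𝓡 d) ∞ (fun z : Eu n × M => g z.1 z.2)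
        (u ×ˢ Set.univ) ∧
      ContMDiffOn (𝓘(ℝ, Eu n).prod (𝓡 d)) (𝓡 d) ∞ (fun z : Eu n × M => (g z.1).symm z.2)
        (u ×ˢ Set.univ)
    isPlot := fun {n} g =>
      ContMDiff (𝓘(ℝ, Eu n).prod (𝓡 d)) (𝓡 d) ∞ (fun z : Eu n × M => g z.1 z.2) ∧
      ContMDiff (𝓘(ℝ, Eu n).prod (𝓡 d)) (𝓡 d) ∞ (fun z : Eu n × M => (g z.1).symm z.2)
    isPlotOn_congr := fun _ p q h => by
      refine and_congr (contMDiffOn_congr fun z hz => ?_) (contMDiffOn_congr fun z hz => ?_)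
      · rw [h hz.1]
      · rw [h hz.1]
    isPlotOn_univ := by simp [Set.univ_prod_univ, contMDiffOn_univ]
    isPlot_const := fun g => ⟨g.contMDiff.comp contMDiff_snd, g.symm.contMDiff.comp contMDiff_snd⟩
    isPlotOn_reparam := fun _ _ _ h hp hf =>
      ⟨contMDiffOn_prod_univ_reparam hf h hp.1, contMDiffOn_prod_univ_reparam hf h hp.2⟩
    locality := fun _ p h => by
      constructor
      · refine contMDiffOn_prod_univ_of_local fun x hx => ?_
        obtain ⟨v, hv, hxv, hp⟩ := h x hx
        exact ⟨v, hv, hxv, hp.1⟩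
      · refine contMDiffOn_prod_univ_of_local fun x hx => ?_
        obtain ⟨v, hv, hxv, hp⟩ := h x hx
        exact ⟨v, hv, hxv, hp.2⟩ }

theorem isPlot_diff_iff {n : ℕ} {g : Eu n → Diff d M} :
    IsPlot g ↔
      ContMDiff (𝓘(ℝ, Eu n).prod (𝓡 d)) (𝓡 d) ∞ (fun z : Eu n × M => g z.1 z.2) ∧
      ContMDiff (𝓘(ℝ, Eu n).prod (𝓡 d)) (𝓡 d) ∞ (fun z : Eu n × M => (g z.1).symm z.2) :=
  Iff.rfl

/-- The differential of a diffeomorphism is invertible. -/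
theorem Diff.isInvertible_mfderiv (ψ : Diff d M) (m : M) :
    (mfderiv (𝓡 d) (𝓡 d) ψ m).IsInvertible :=
  ⟨ψ.mfderivToContinuousLinearEquiv (by simp) m, ψ.mfderivToContinuousLinearEquiv_coe (by simp)⟩

/-- The differential of the inverse is the inverse of the differential. -/
theorem Diff.mfderiv_symm_apply (ψ : Diff d M) (m : M) (w : TangentSpace (𝓡 d) (ψ m)) :
    (mfderiv (𝓡 d) (𝓡 d) ψ.symm (ψ m) w : Eu d) = (mfderiv (𝓡 d) (𝓡 d) ψ m).inverse w := by
  obtain ⟨v, rfl⟩ := (Diff.isInvertible_mfderiv ψ m).bijective.2 w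
  have h1 : MDifferentiableAt (𝓡 d) (𝓡 d) ψ.symm (ψ m) :=
    ψ.symm.contMDiff.mdifferentiable (by simp) _
  have h2 : MDifferentiableAt (𝓡 d) (𝓡 d) ψ m := ψ.contMDiff.mdifferentiable (by simp) _
  have h3 := mfderiv_comp m h1 h2
  have h4 : ψ.symm ∘ ψ = id := funext ψ.symm_apply_apply
  rw [h4, mfderiv_id] at h3
  have h5 := congrArg (fun L : Eu d →L[ℝ] Eu d => L v) h3
  have h6 := (Diff.isInvertible_mfderiv ψ m).inverse_apply_eq
    (x := v) (y := mfderiv (𝓡 d) (𝓡 d) ψ m v)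
  exact h5.symm.trans (h6.2 rfl).symm

variable [IsManifold (𝓡 d) ∞ M]

variable (d M) in
/-- The smooth vector fields on `M`: the vector space underlying the Lie algebra `𝔡𝔦𝔣𝔣(M)`. -/
abbrev VField : Type _ :=
  ContMDiffSection (𝓡 d) (Eu d) ∞ (TangentSpace (𝓡 d) : M → Type _)

/-- The functional diffeology of the space of vector fields: a family `X : ℝⁿ → Γ(TM)` is smooth
iff `(x, m) ↦ X x m ∈ TM` is smooth. -/
instance instDiffeologyVField : DiffeologicalSpace (VField d M) :=
  .ofCorePlotsOn {
    isPlotOn := fun {n u} _ X =>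
      ContMDiffOn (𝓘(ℝ, Eu n).prod (𝓡 d)) (𝓡 d).tangent ∞
        (fun z : Eu n × M => (⟨z.2, X z.1 z.2⟩ : TangentBundle (𝓡 d) M)) (u ×ˢ Set.univ)
    isPlot := fun {n} X =>
      ContMDiff (𝓘(ℝ, Eu n).prod (𝓡 d)) (𝓡 d).tangent ∞
        (fun z : Eu n × M => (⟨z.2, X z.1 z.2⟩ : TangentBundle (𝓡 d) M))
    isPlotOn_congr := fun _ p q h => contMDiffOn_congr fun z hz => by rw [h hz.1]
    isPlotOn_univ := by simp [Set.univ_prod_univ, contMDiffOn_univ]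
    isPlot_const := fun X => X.contMDiff.comp contMDiff_snd
    isPlotOn_reparam := fun _ _ _ h hp hf => contMDiffOn_prod_univ_reparam hf h hp
    locality := fun _ p h => contMDiffOn_prod_univ_of_local fun x hx => by
      obtain ⟨v, hv, hxv, hp⟩ := h x hx
      exact ⟨v, hv, hxv, hp⟩ }

/-- The vector field `(ψ⁻¹)_* X ∘ ψ`, whose value at `m` is `(T_m ψ)⁻¹ (X (ψ m))`. -/
def conjField (ψ : Diff d M) (X : VField d M) : VField d M where
  toFun m := (mfderiv (𝓡 d) (𝓡 d) ψ m).inverse (X (ψ m))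
  contMDiff_toFun := by
    have h := ContMDiff.mpullback_vectorField (m := ∞) (n := ∞) (I := 𝓡 d) (I' := 𝓡 d)
      (f := ψ) (V := fun m => X m) X.contMDiff ψ.contMDiff ψ.isInvertible_mfderiv (by simp)
    exact h

/-- `X ↦ (ψ⁻¹)_* X ∘ ψ` as a linear map of `𝔡𝔦𝔣𝔣(M)`. -/
def conjLin (ψ : Diff d M) : VField d M →ₗ[ℝ] VField d M where
  toFun := conjField ψ
  map_add' X Y := by
    ext m
    exact map_add (mfderiv (𝓡 d) (𝓡 d) ψ m).inverse (X (ψ m)) (Y (ψ m))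
  map_smul' c X := by
    ext m
    exact map_smul (mfderiv (𝓡 d) (𝓡 d) ψ m).inverse c (X (ψ m))

end Manifold

section Plots

/-- The smooth maps `ℝⁿ → X` into a diffeological space. -/
structure Plot (n : ℕ) (X : Type*) [DiffeologicalSpace X] where
  /-- the underlying map -/
  toFun : Eu n → X
  /-- it is smooth -/
  isPlot : IsPlot toFun

instance {n : ℕ} {X : Type*} [DiffeologicalSpace X] : CoeFun (Plot n X) (fun _ => Eu n → X) :=
  ⟨Plot.toFun⟩

/-- The space `C^∞(X, Y)` of smooth maps between diffeological spaces. -/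
structure SmoothMap (X Y : Type*) [DiffeologicalSpace X] [DiffeologicalSpace Y] where
  /-- the underlying map -/
  toFun : X → Y
  /-- it is smooth -/
  smooth : DSmooth toFun

instance {X Y : Type*} [DiffeologicalSpace X] [DiffeologicalSpace Y] :
    CoeFun (SmoothMap X Y) (fun _ => X → Y) :=
  ⟨SmoothMap.toFun⟩

variable {X Y : Type*} [DiffeologicalSpace X] [DiffeologicalSpace Y] {n k : ℕ}

/-- The composition `F ∘ p` of a plot `p` with a smooth map `F`. -/
def Plot.map (p : Plot n X) (F : SmoothMap X Y) : Plot n Y :=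
  ⟨fun x => F (p x), p.isPlot.dSmooth_comp' F.smooth⟩

/-- The reparametrisation `p ∘ f` of a plot `p`. -/
def Plot.reparam (p : Plot n X) (f : Eu k → Eu n) (hf : ContDiff ℝ ∞ f) : Plot k X :=
  ⟨fun x => p (f x), isPlot_reparam p.isPlot hf⟩

end Plots

section LogDerivative

variable {d : ℕ} {M : Type*} [TopologicalSpace M] [ChartedSpace (Eu d) M]
  {n : ℕ}

theorem Plot.contMDiff_eval (g : Plot n (Diff d M)) :
    ContMDiff (𝓘(ℝ, Eu n).prod (𝓡 d)) (𝓡 d) ∞ (fun z : Eu n × M => g z.1 z.2) :=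
  (isPlot_diff_iff.1 g.isPlot).1

variable [IsManifold (𝓡 d) ∞ M]

/-- The vector field `(g⁻¹)_* dg` on `M`, at `x` and in the direction `v`, of a smooth family
`g : ℝⁿ → Diff(M)`. Its value at `m` is `(T_m g_x)⁻¹ (d/dt g_{x + t v}(m))`, i.e. it is the
velocity at `t = 0` of the curve `g_x⁻¹ ∘ g_{x + t v}` in `Diff(M)`. -/
def leftLogDeriv (g : Plot n (Diff d M)) (x v : Eu n) : VField d M where
  toFun m := (mfderiv (𝓡 d) (𝓡 d) (g x) m).inverse
    (mfderiv 𝓘(ℝ, Eu n) (𝓡 d) (fun y : Eu n => g y m) x v)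
  contMDiff_toFun := by
    let F : Eu n × M → M := fun z => (g x).symm (g z.1 z.2)
    have hF : ContMDiff (𝓘(ℝ, Eu n).prod (𝓡 d)) (𝓡 d) ∞ F :=
      (g x).symm.contMDiff.comp g.contMDiff_eval
    let σ : M → TangentBundle (𝓘(ℝ, Eu n).prod (𝓡 d)) (Eu n × M) := fun m =>
      (equivTangentBundleProd 𝓘(ℝ, Eu n) (Eu n) (𝓡 d) M).symm (⟨x, v⟩, ⟨m, 0⟩)
    have hσ : ContMDiff (𝓡 d) (𝓘(ℝ, Eu n).prod (𝓡 d)).tangent ∞ σ :=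
      contMDiff_equivTangentBundleProd_symm.comp
        (contMDiff_const.prodMk
          (Bundle.contMDiff_zeroSection ℝ (TangentSpace (𝓡 d) : M → Type _)))
    have h := (hF.contMDiff_tangentMap (m := ∞) (by simp)).comp hσ
    refine h.congr fun m => ?_
    have key : ∀ (m' : M) (_ : m' = m) (a b : Eu d), a = b →
        (⟨m, b⟩ : TangentBundle (𝓡 d) M) = ⟨m', a⟩ := by
      rintro m' rfl a b rfl
      rfl
    refine key _ ((g x).symm_apply_apply m) _ _ ?_
    have hG : MDifferentiableAt (𝓘(ℝ, Eu n).prod (𝓡 d)) (𝓡 d)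
        (fun z : Eu n × M => g z.1 z.2) (x, m) := g.contMDiff_eval.mdifferentiable (by simp) _
    have hs : MDifferentiableAt (𝓡 d) (𝓡 d) (g x).symm (g x m) :=
      (g x).symm.contMDiff.mdifferentiable (by simp) _
    have hi : MDifferentiableAt 𝓘(ℝ, Eu n) (𝓘(ℝ, Eu n).prod (𝓡 d))
        (fun y : Eu n => ((y, m) : Eu n × M)) x :=
      mdifferentiableAt_id.prodMk mdifferentiableAt_const
    have e1 := mfderiv_comp (x, m) (I' := 𝓡 d) hs hG
    have e2 := mfderiv_comp x hG hi
    rw [mfderiv_prod_left] at e2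
    have e1' := congrArg (fun L : (Eu n × Eu d) →L[ℝ] Eu d => L (v, 0)) e1
    have e2' := congrArg (fun L : Eu n →L[ℝ] Eu d => L v) e2
    have e4 := Diff.mfderiv_symm_apply (g x) m
      (mfderiv (𝓘(ℝ, Eu n).prod (𝓡 d)) (𝓡 d) (fun z : Eu n × M => g z.1 z.2) (x, m) (v, 0))
    refine (e1'.trans e4).trans ?_
    exact congrArg (fun w : Eu d => ((mfderiv (𝓡 d) (𝓡 d) (g x) m).inverse : Eu d →L[ℝ] Eu d) w)
      e2'.symm

/-- `leftLogDeriv g x v` is linear in `v`. -/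
def leftLogDerivLin (g : Plot n (Diff d M)) (x : Eu n) : Eu n →ₗ[ℝ] VField d M where
  toFun := leftLogDeriv g x
  map_add' v w := by
    ext m
    exact map_add ((mfderiv (𝓡 d) (𝓡 d) (g x) m).inverse.comp
      (mfderiv 𝓘(ℝ, Eu n) (𝓡 d) (fun y : Eu n => g y m) x)) v w
  map_smul' c v := by
    ext m
    exact map_smul ((mfderiv (𝓡 d) (𝓡 d) (g x) m).inverse.comp
      (mfderiv 𝓘(ℝ, Eu n) (𝓡 d) (fun y : Eu n => g y m) x)) c v

end LogDerivative

section FieldSpace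

/-- `Φ` is acted upon smoothly from the right by `Diff(M)`. The right action is Mathlib's
`φ <• ψ`, i.e. `MulOpposite.op ψ • φ`; it stands for `R_ψ φ = ψ^* φ`. -/
class SmoothRightAction (d : ℕ) (M : Type*) [TopologicalSpace M] [ChartedSpace (Eu d) M]
    (Φ : Type*) [DiffeologicalSpace Φ] [MulAction (Diff d M)ᵐᵒᵖ Φ] : Prop where
  /-- the action map `Φ × Diff(M) → Φ` is smooth -/
  smooth : ∀ {n : ℕ} {p : Eu n → Φ} {g : Eu n → Diff d M}, IsPlot p → IsPlot g →
    IsPlot fun x => p x <• g x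

variable {d : ℕ} {M : Type*} [TopologicalSpace M] [ChartedSpace (Eu d) M]
  {Φ : Type*} [DiffeologicalSpace Φ] {V : Type*} [AddCommGroup V] [Module ℝ V]
  {k : ℕ}

/-- A family of pointwise alternating `k`-forms with values in `V`, one for each plot of `Φ`
(the components of a candidate differential form on `Φ`). -/
def PreForm (k : ℕ) (Φ : Type*) [DiffeologicalSpace Φ] (V : Type*) [AddCommGroup V]
    [Module ℝ V] : Type _ :=
  ∀ ⦃n : ℕ⦄, Plot n Φ → Eu n → (Eu n) [⋀^Fin k]→ₗ[ℝ] V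

/-- `α` is a smooth differential `k`-form on the diffeological space `Φ` with values in `V`. -/
structure IsForm [DiffeologicalSpace V] (α : PreForm k Φ V) : Prop where
  /-- compatibility with reparametrisations: `α_{p ∘ f} = f^* α_p` -/
  reparam : ∀ {m n : ℕ} (p : Plot n Φ) (f : Eu m → Eu n) (hf : ContDiff ℝ ∞ f) (x : Eu m),
    α (p.reparam f hf) x =
      (α p (f x)).compLinearMap ((fderiv ℝ f x : Eu m →L[ℝ] Eu n) : Eu m →ₗ[ℝ] Eu n)
  /-- smoothness of the values on smooth vector fields of the domain of each plot -/
  smooth : ∀ {n : ℕ} (p : Plot n Φ) (v : Fin k → Eu n → Eu n), (∀ i, ContDiff ℝ ∞ (v i)) →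
    IsPlot fun x => α p x fun i => v i x

/-- The pullback `F^⋆ α` along a smooth map `F : Φ → Φ`. -/
def PreForm.pullback (F : SmoothMap Φ Φ) (α : PreForm k Φ V) : PreForm k Φ V :=
  fun _ p x => α (p.map F) x

/-- The form `φ ↦ L(φ) ∘ α_φ`, for a family of linear maps `L(φ) : V → V`. -/
def PreForm.act (L : Φ → V →ₗ[ℝ] V) (α : PreForm k Φ V) : PreForm k Φ V :=
  fun _ p x => (L (p x)).compAlternatingMap (α p x)

/-- Pointwise addition. -/
instance instAddPreForm : Add (PreForm k Φ V) where
  add α β := fun _ p x => α p x + β p x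

variable [MulAction (Diff d M)ᵐᵒᵖ Φ] [SmoothRightAction d M Φ]

/-- The map `φ ↦ R_{𝛙(φ)} φ = 𝛙(φ)^* φ` of `Φ` generated by a smooth map `𝛙 : Φ → Diff(M)`. -/
def verticalMap (ψ : SmoothMap Φ (Diff d M)) : SmoothMap Φ Φ where
  toFun φ := φ <• ψ φ
  smooth _ _ hp := SmoothRightAction.smooth (M := M) hp (hp.dSmooth_comp' ψ.smooth)

/-- The right action `R_ψ` of a single diffeomorphism `ψ`. -/
def rightMap (ψ : Diff d M) : SmoothMap Φ Φ :=
  verticalMap ⟨fun _ => ψ, dSmooth_const⟩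

/-- `H`-invariance: `R_ψ^⋆ α = α` for all `ψ ∈ H`. -/
def IsInvariant (H : Subgroup (Diff d M)) (α : PreForm k Φ V) : Prop :=
  ∀ ψ ∈ H, α.pullback (rightMap ψ) = α

variable [IsManifold (𝓡 d) ∞ M]

/-- The tangent vector `∂_w q (y)` of the plot `q` is the fundamental vertical vector `X^v` at the
point `q y`, where `X` is the velocity at the identity of a smooth family of elements of `H`:
one has `q = p · g`, where `p` does not vary in the direction `w`, and where `g` is a smooth
family of elements of `H` with `g y = id` and `∂_w g (y) = X`. Along the line `y + t w` this reads
`q (y + t w) = R_{ψ_t} φ` with `φ = q y`, `ψ_t = g (y + t w)`, `ψ_0 = id` and `d/dt ψ_t = X` at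
`t = 0`. -/
def IsFundamental (H : Subgroup (Diff d M)) {n : ℕ} (q : Plot n Φ) (y w : Eu n)
    (X : VField d M) : Prop :=
  ∃ (p : Plot n Φ) (g : Plot n (Diff d M)),
    (∀ (z : Eu n) (t : ℝ), p (z + t • w) = p z) ∧ (∀ z, g z ∈ H) ∧ g y = 1 ∧
    (∀ z, q z = p z <• g z) ∧ leftLogDeriv g y w = X

/-- `ι_{X^v} α = 0` for all `X` in the Lie algebra of `H`. -/
def IsHorizontal (H : Subgroup (Diff d M)) (α : PreForm k Φ V) : Prop :=
  ∀ {n : ℕ} (q : Plot n Φ) (y w : Eu n) (X : VField d M), IsFundamental H q y w X →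
    ∀ (v : Fin k → Eu n) (i : Fin k), v i = w → α q y v = 0

/-- `H`-basic forms: invariant and horizontal. -/
structure IsBasic [DiffeologicalSpace V] (H : Subgroup (Diff d M)) (α : PreForm k Φ V) : Prop where
  isForm : IsForm α
  invariant : IsInvariant H α
  horizontal : IsHorizontal H α

/-- The `ρ`-tensorial forms `Ω_tens(Φ, ρ)` for the structure group `H`: horizontal forms with
`R_ψ^⋆ α = ρ(ψ)⁻¹ α` for all `ψ ∈ H`. -/
structure IsTensorial [DiffeologicalSpace V] (H : Subgroup (Diff d M))
    (ρ : Representation ℝ (Diff d M) V) (α : PreForm k Φ V) : Prop where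
  isForm : IsForm α
  equivariant : ∀ ψ ∈ H, α.pullback (rightMap ψ) = α.act fun _ => ρ ψ⁻¹
  horizontal : IsHorizontal H α

/-- Ehresmann connections for the structure group `H`: `𝔡𝔦𝔣𝔣(M)`-valued 1-forms with
`ω(X^v) = X` for `X` in the Lie algebra of `H`, and `R_ψ^⋆ ω = (ψ⁻¹)_* ω ∘ ψ` for `ψ ∈ H`. -/
structure IsConnection (H : Subgroup (Diff d M)) (conn : PreForm 1 Φ (VField d M)) : Prop where
  isForm : IsForm conn
  vertical : ∀ {n : ℕ} (q : Plot n Φ) (y w : Eu n) (X : VField d M), IsFundamental H q y w X →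
    conn q y (fun _ => w) = X
  equivariant : ∀ ψ ∈ H, conn.pullback (rightMap ψ) = conn.act fun _ => conjLin ψ

/-- The 1-form `(𝛙⁻¹)_* d𝛙` on `Φ` with values in `𝔡𝔦𝔣𝔣(M)`, for a smooth map
`𝛙 : Φ → Diff(M)`. -/
def maurerCartan (ψ : SmoothMap Φ (Diff d M)) : PreForm 1 Φ (VField d M) :=
  fun n p x => AlternatingMap.ofSubsingleton ℝ (Eu n) (VField d M) (0 : Fin 1)
    (leftLogDerivLin (p.map ψ) x)

/-- The dressing `α^u = F_u^⋆ α` of a form by a smooth map `u : Φ → Diff(M)`, where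
`F_u(φ) = u(φ)^* φ`. -/
def dress (u : SmoothMap Φ (Diff d M)) (α : PreForm k Φ V) : PreForm k Φ V :=
  α.pullback (verticalMap u)

end FieldSpace

end FieldSpace

end

open FieldSpace

/-! The heart is a Leibniz rule. Near `x`, the plot `z ↦ R_{g z} (p z)` is the diagonal of the plot
`(a, b) ↦ R_{g b} (p a)`, in which the variations of `p` and of `g` are independent
(`exists_splitting`). Its `b`-directions at `b = x` are fundamental vertical vectors with velocity
`leftLogDeriv g x`, while its slice `b = x` is `p` moved by the single diffeomorphism `g x`.
Multilinearity and the axioms in the vertical directions then give the pullback of a tensorial form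
or of a connection along any `verticalMap ψ` with values in `H`.

The rest follows from how `F_u = verticalMap u` meets the action: it is constant along
`Diff₀`-orbits and commutes with the residual group. Hence pullbacks along it are `Diff₀`-basic, and
stay tensorial, or a connection, for the residual group. The pullback formulas are applied twice: to
the original form with `H = ⊤` and `ψ = u`, and to the dressed form with `H = s.range`. -/

namespace FieldSpace

/-! ### Differential forms on a diffeological space -/

section Forms

variable {Φ : Type*} [DiffeologicalSpace Φ] {V : Type*} [AddCommGroup V] [Module ℝ V]
  [DiffeologicalSpace V] {k : ℕ}

theorem IsForm.pullback {α : PreForm k Φ V} (hα : IsForm α) (F : SmoothMap Φ Φ) :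
    IsForm (α.pullback F) where
  reparam p f hf x := hα.reparam (p.map F) f hf x
  smooth p v hv := hα.smooth (p.map F) v hv

theorem Plot.ext {X : Type*} [DiffeologicalSpace X] {n : ℕ} {p q : Plot n X}
    (h : ∀ x, p x = q x) : p = q := by
  cases p
  cases q
  congr
  exact funext h

/-- Compatibility of a form with reparametrisation along a continuous affine map. -/
theorem IsForm.reparam_affine {α : PreForm k Φ V} (hα : IsForm α) {m n : ℕ} {q : Plot m Φ}
    {p : Plot n Φ} (L : Eu m →L[ℝ] Eu n) (c : Eu n) (h : ∀ z, q z = p (L z + c)) (x : Eu m)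
    (v : Fin k → Eu m) : α q x v = α p (L x + c) fun i => L (v i) := by
  have hf : ContDiff ℝ ∞ fun z => L z + c := L.contDiff.add contDiff_const
  have hq : q = p.reparam (fun z => L z + c) hf := Plot.ext h
  have hd : fderiv ℝ (fun z => L z + c) x = L := by
    rw [fderiv_add_const, L.fderiv]
  rw [hq, hα.reparam, hd]
  rfl

/-- A form vanishes on the directions in which a plot does not vary. -/
theorem IsForm.apply_eq_zero_of_invariant {α : PreForm k Φ V} (hα : IsForm α) {n : ℕ}
    (p : Plot n Φ) {w : Eu n} (hp : ∀ (z : Eu n) (t : ℝ), p (z + t • w) = p z) (y : Eu n)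
    (v : Fin k → Eu n) (i : Fin k) (hi : v i = w) : α p y v = 0 := by
  -- Orthogonal projection along `w`: it moves points only by multiples of `w`, so `p ∘ L = p`, yet
  -- it kills `w`. For `w = 0` the convention `0⁻¹ = 0` makes it the identity, which is harmless.
  let L : Eu n →L[ℝ] Eu n :=
    ContinuousLinearMap.id ℝ (Eu n) - ((inner ℝ w w)⁻¹ • (innerSL ℝ w)).smulRight w
  have hL : ∀ z, L z = z + (-((inner ℝ w w)⁻¹ * inner ℝ w z)) • w := fun z => by
    simp [L, sub_eq_add_neg]
  have hw : L w = 0 := by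
    rw [hL]
    by_cases h : w = 0
    · simp [h]
    · rw [inv_mul_cancel₀ (inner_self_ne_zero.2 h)]
      simp
  rw [hα.reparam_affine L 0 (fun z => by rw [add_zero, hL, hp]) y v]
  exact (α p _).map_coord_zero i (by rw [hi, hw])

end Forms

/-! ### Pullback along field-dependent diffeomorphisms -/

section Action

variable {d : ℕ} {M : Type*} [TopologicalSpace M] [ChartedSpace (Eu d) M]

theorem rightAct_mul {Φ : Type*} [MulAction (Diff d M)ᵐᵒᵖ Φ] (φ : Φ) (a b : Diff d M) :
    φ <• (a * b) = (φ <• a) <• b := by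
  rw [MulOpposite.op_mul, mul_smul]

/-- Left translation of a smooth family of diffeomorphisms by a diffeomorphism. -/
noncomputable def Plot.leftMul {n : ℕ} (a : Diff d M) (g : Plot n (Diff d M)) : Plot n (Diff d M) where
  toFun x := a * g x
  isPlot := by
    have hg := isPlot_diff_iff.1 g.isPlot
    exact isPlot_diff_iff.2 ⟨a.contMDiff.comp hg.1,
      hg.2.comp (contMDiff_fst.prodMk (a.symm.contMDiff.comp contMDiff_snd))⟩

variable {Φ : Type*} [DiffeologicalSpace Φ] [MulAction (Diff d M)ᵐᵒᵖ Φ]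

/-- The plot `x ↦ R_{g x} (p x)`. -/
def Plot.rightAct [SmoothRightAction d M Φ] {n : ℕ} (p : Plot n Φ) (g : Plot n (Diff d M)) :
    Plot n Φ :=
  ⟨fun x => p x <• g x, SmoothRightAction.smooth p.isPlot g.isPlot⟩

variable [IsManifold (𝓡 d) ∞ M]

/-- The left logarithmic derivative of `g(x)⁻¹ g ∘ L` at a point over `x`. -/
theorem leftLogDeriv_leftMul_inv_reparam {k n : ℕ} (g : Plot n (Diff d M)) (L : Eu k →L[ℝ] Eu n)
    (y w : Eu k) :
    leftLogDeriv ((g.reparam L L.contDiff).leftMul (g (L y))⁻¹) y w =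
      leftLogDeriv g (L y) (L w) := by
  ext m
  have h1 : ((g.reparam L L.contDiff).leftMul (g (L y))⁻¹) y = 1 := inv_mul_cancel (g (L y))
  have h2 : MDifferentiableAt 𝓘(ℝ, Eu n) (𝓡 d) (fun z : Eu n => g z m) (L y) :=
    (g.contMDiff_eval.comp (contMDiff_id.prodMk contMDiff_const)).mdifferentiable (by simp) _
  have h3 : MDifferentiableAt (𝓡 d) (𝓡 d) (g (L y)).symm (g (L y) m) :=
    (g (L y)).symm.contMDiff.mdifferentiable (by simp) _
  have h4 : MDifferentiableAt 𝓘(ℝ, Eu k) 𝓘(ℝ, Eu n) L y := L.differentiableAt.mdifferentiableAt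
  have e1 := mfderiv_comp y h2 h4
  have e2 := mfderiv_comp y (f := fun z => g (L z) m) h3 (h2.comp y h4)
  have e1' := congrArg (fun A : Eu k →L[ℝ] Eu d => A w) e1
  have e2' := congrArg (fun A : Eu k →L[ℝ] Eu d => A w) e2
  rw [mfderiv_eq_fderiv, L.fderiv] at e1'
  have e3 := Diff.mfderiv_symm_apply (g (L y)) m
    (mfderiv 𝓘(ℝ, Eu n) (𝓡 d) (fun z : Eu n => g z m) (L y) (L w))
  -- The translated family is the identity at `y`, so the inverse differential in its logarithmic
  -- derivative disappears; what remains is the differential of `(g (L y))⁻¹` supplied by the chain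
  -- rule.
  have e4 : (mfderiv (𝓡 d) (𝓡 d) (((g.reparam L L.contDiff).leftMul (g (L y))⁻¹) y) m :
      Eu d →L[ℝ] Eu d) = ContinuousLinearMap.id ℝ (Eu d) := by
    rw [h1]
    exact mfderiv_id
  have e5 (a : Eu d) := (congrArg (fun T : Eu d →L[ℝ] Eu d => T.inverse a) e4).trans
    (congrArg (fun T : Eu d →L[ℝ] Eu d => T a) ContinuousLinearMap.inverse_id)
  refine (e5 _).trans (e2'.trans (Eq.trans ?_ e3))
  exact congrArg (fun a : Eu d =>
    (mfderiv (𝓡 d) (𝓡 d) (g (L y)).symm (g (L y) m) : Eu d →L[ℝ] Eu d) a) e1'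

variable [SmoothRightAction d M Φ] {V : Type*} [AddCommGroup V] [Module ℝ V]
  [DiffeologicalSpace V] {k : ℕ}

/-- The value of a form on `x ↦ R_{g x} (p x)` splits along a plot in which the directions of `p`
and those of `g` are independent; the latter are fundamental. -/
theorem exists_splitting {H : Subgroup (Diff d M)} {n : ℕ} (p : Plot n Φ)
    (g : Plot n (Diff d M)) (hg : ∀ x, g x ∈ H) (x : Eu n) :
    ∃ (m : ℕ) (P : Plot m Φ) (y : Eu m) (A B : Eu n →L[ℝ] Eu m),
      (∀ w, IsFundamental H P y (B w) (leftLogDeriv g x w)) ∧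
      ∀ {k : ℕ} (α : PreForm k Φ V), IsForm α → ∀ v : Fin k → Eu n,
        α (p.rightAct g) x v = α P y (fun i => A (v i) + B (v i)) ∧
        α (p.map (rightMap (g x))) x v = α P y fun i => A (v i) := by
  -- Plots have domains `Eu m` only, so `Eu n × Eu n` is carried over to `Eu (n + n)`; `A` and `B`
  -- are the two inclusions, `p₁` and `p₂` the projections.
  let e : Eu (n + n) ≃L[ℝ] Eu n × Eu n := ContinuousLinearEquiv.ofFinrankEq (by simp)
  let p₁ : Eu (n + n) →L[ℝ] Eu n := (ContinuousLinearMap.fst ℝ (Eu n) (Eu n)).comp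
    (e : Eu (n + n) →L[ℝ] Eu n × Eu n)
  let p₂ : Eu (n + n) →L[ℝ] Eu n := (ContinuousLinearMap.snd ℝ (Eu n) (Eu n)).comp
    (e : Eu (n + n) →L[ℝ] Eu n × Eu n)
  let A : Eu n →L[ℝ] Eu (n + n) :=
    (e.symm : Eu n × Eu n →L[ℝ] Eu (n + n)).comp (ContinuousLinearMap.inl ℝ (Eu n) (Eu n))
  let B : Eu n →L[ℝ] Eu (n + n) :=
    (e.symm : Eu n × Eu n →L[ℝ] Eu (n + n)).comp (ContinuousLinearMap.inr ℝ (Eu n) (Eu n))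
  have h1A : ∀ z, p₁ (A z) = z := fun z => by simp [p₁, A]
  have h1B : ∀ z, p₁ (B z) = 0 := fun z => by simp [p₁, B]
  have h2A : ∀ z, p₂ (A z) = 0 := fun z => by simp [p₂, A]
  have h2B : ∀ z, p₂ (B z) = z := fun z => by simp [p₂, B]
  let P : Plot (n + n) Φ := (p.reparam p₁ p₁.contDiff).rightAct (g.reparam p₂ p₂.contDiff)
  have hP : ∀ z, P z = p (p₁ z) <• g (p₂ z) := fun _ => rfl
  have hx : p₂ (A x + B x) = x := by rw [map_add, h2A, h2B, zero_add]
  refine ⟨n + n, P, A x + B x, A, B, fun w => ?_, fun α hα v => ⟨?_, ?_⟩⟩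
  -- Factor `R_{g b} (p a)` as `R_{g(x)⁻¹ g(b)}` applied to `R_{g x} (p a)`: the inner point does
  -- not depend on `b`, and the group element is `1` at `b = x`.
  · refine ⟨(p.reparam p₁ p₁.contDiff).map (rightMap (g x)),
      (g.reparam p₂ p₂.contDiff).leftMul (g x)⁻¹, fun z t => ?_, fun z => ?_, ?_, fun z => ?_, ?_⟩
    · change p (p₁ (z + t • B w)) <• g x = p (p₁ z) <• g x
      rw [map_add, map_smul, h1B, smul_zero, add_zero]
    · exact H.mul_mem (H.inv_mem (hg x)) (hg _)
    · change (g x)⁻¹ * g (p₂ (A x + B x)) = 1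
      rw [hx, inv_mul_cancel]
    · change p (p₁ z) <• g (p₂ z) = (p (p₁ z) <• g x) <• ((g x)⁻¹ * g (p₂ z))
      rw [← rightAct_mul, mul_inv_cancel_left]
    · have h := leftLogDeriv_leftMul_inv_reparam g p₂ (A x + B x) (B w)
      rwa [hx, h2B] at h
  · have h := hα.reparam_affine (q := p.rightAct g) (p := P) (A + B) 0 (fun z => by
      rw [hP]
      simp [h1A, h1B, h2A, h2B, Plot.rightAct]) x v
    simpa using h
  · exact hα.reparam_affine (q := p.map (rightMap (g x))) (p := P) A (B x) (fun z => by
      rw [hP]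
      simp [h1A, h1B, h2A, h2B, Plot.map, rightMap, verticalMap]) x v

/-- The variation of `ψ` adds only vertical vectors, which `α` annihilates, so `ψ` may be frozen at
its value at the point, where equivariance applies. -/
theorem IsTensorial.pullback_verticalMap {H : Subgroup (Diff d M)}
    {ρ : Representation ℝ (Diff d M) V} {α : PreForm k Φ V} (hα : IsTensorial H ρ α)
    (ψ : SmoothMap Φ (Diff d M)) (hψ : ∀ φ, ψ φ ∈ H) :
    α.pullback (verticalMap ψ) = α.act fun φ => ρ (ψ φ)⁻¹ := by
  funext n p x
  ext v
  obtain ⟨m, P, y, A, B, hB, h⟩ := exists_splitting (V := V) p (p.map ψ) (fun z => hψ (p z)) x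
  obtain ⟨h1, h2⟩ := h α hα.isForm v
  have h3 : α P y (fun i => A (v i) + B (v i)) = α P y fun i => A (v i) := by
    -- The expansion runs over the sets `s` of slots filled by `A`; every `s` other than
    -- `Finset.univ` leaves a vertical vector `B (v i)` in some slot.
    have := (α P y).toMultilinearMap.map_add_univ (fun i => A (v i)) (fun i => B (v i))
    refine this.trans ((Finset.sum_eq_single_of_mem Finset.univ (Finset.mem_univ _)
      fun s _ hs => ?_).trans (by simp))
    obtain ⟨i, hi⟩ : ∃ i, i ∉ s := by
      simpa [Finset.eq_univ_iff_forall] using hs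
    exact hα.horizontal P y _ _ (hB (v i)) _ i (by simp [hi])
  have h4 := congrArg (fun β : PreForm k Φ V => β p x v) (hα.equivariant (ψ (p x)) (hψ _))
  exact h1.trans (h3.trans (h2.symm.trans h4))

/-- Here the vertical part survives: the connection returns its velocity, the logarithmic derivative
of `ψ` along the plot, which is the Maurer–Cartan term. -/
theorem IsConnection.pullback_verticalMap {H : Subgroup (Diff d M)}
    {conn : PreForm 1 Φ (VField d M)} (hc : IsConnection H conn)
    (ψ : SmoothMap Φ (Diff d M)) (hψ : ∀ φ, ψ φ ∈ H) :
    conn.pullback (verticalMap ψ) = conn.act (fun φ => conjLin (ψ φ)) + maurerCartan ψ := by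
  funext n p x
  refine AlternatingMap.ext fun v => ?_
  obtain ⟨m, P, y, A, B, hB, h⟩ :=
    exists_splitting (V := VField d M) p (p.map ψ) (fun z => hψ (p z)) x
  obtain ⟨h1, h2⟩ := h conn hc.isForm v
  have h3 : conn P y (fun i => A (v i) + B (v i)) =
      conn P y (fun i => A (v i)) + conn P y fun i => B (v i) := by
    have h := (conn P y).map_update_add (fun _ => 0) 0 (A (v 0)) (B (v 0))
    have hu : ∀ a : Fin 1 → Eu m, Function.update (fun _ => (0 : Eu m)) (0 : Fin 1) (a 0) = a :=
      fun a => by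
        ext i
        rw [Subsingleton.elim i 0, Function.update_self]
    rwa [hu fun i => A (v i) + B (v i), hu fun i => A (v i), hu fun i => B (v i)] at h
  have h4 := congrArg (fun β : PreForm 1 Φ (VField d M) => β p x v)
    (hc.equivariant (ψ (p x)) (hψ _))
  have h5 : conn P y (fun i => B (v i)) = leftLogDeriv (p.map ψ) x (v 0) := by
    have : (fun i => B (v i)) = fun _ : Fin 1 => B (v 0) :=
      funext fun i => by rw [Subsingleton.elim i 0]
    rw [this]
    exact hc.vertical P y _ _ (hB (v 0))
  exact h1.trans (h3.trans (congrArg₂ (· + ·) (h2.symm.trans h4) h5))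

end Action

/-! ### Dressed forms -/

section Dressing

variable {d : ℕ} {M : Type*} [TopologicalSpace M] [ChartedSpace (Eu d) M]
  {Φ : Type*} [DiffeologicalSpace Φ] [MulAction (Diff d M)ᵐᵒᵖ Φ] [SmoothRightAction d M Φ]
  {V : Type*} [AddCommGroup V] [Module ℝ V] {k : ℕ}

theorem verticalMap_rightAct_of_eq_inv_mul {u : SmoothMap Φ (Diff d M)} {ψ : Diff d M} {φ : Φ}
    (h : u (φ <• ψ) = ψ⁻¹ * u φ) : verticalMap u (φ <• ψ) = verticalMap u φ := by
  change (φ <• ψ) <• u (φ <• ψ) = φ <• u φ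
  rw [h, ← rightAct_mul, mul_inv_cancel_left]

theorem verticalMap_rightAct_of_eq_conj {u : SmoothMap Φ (Diff d M)} {ψ : Diff d M} {φ : Φ}
    (h : u (φ <• ψ) = ψ⁻¹ * u φ * ψ) : verticalMap u (φ <• ψ) = verticalMap u φ <• ψ := by
  change (φ <• ψ) <• u (φ <• ψ) = (φ <• u φ) <• ψ
  rw [h, ← rightAct_mul, ← rightAct_mul, mul_assoc, mul_inv_cancel_left]

theorem isInvariant_dress {H : Subgroup (Diff d M)} {u : SmoothMap Φ (Diff d M)}
    (hu : ∀ ψ ∈ H, ∀ φ : Φ, u (φ <• ψ) = ψ⁻¹ * u φ) (α : PreForm k Φ V) :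
    IsInvariant H (dress u α) := by
  intro ψ hψ
  funext n p x
  have h : (p.map (rightMap ψ)).map (verticalMap u) = p.map (verticalMap u) :=
    Plot.ext fun z => verticalMap_rightAct_of_eq_inv_mul (hu ψ hψ (p z))
  exact congrArg (fun q => α q x) h

/-- `F_u` commutes with `R_ψ`. The map `T` is left arbitrary to cover both `ρ ψ⁻¹` and `conjLin ψ`.
-/
theorem pullback_rightMap_dress {H : Subgroup (Diff d M)} {u : SmoothMap Φ (Diff d M)}
    (hu : ∀ ψ ∈ H, ∀ φ : Φ, u (φ <• ψ) = ψ⁻¹ * u φ * ψ) (α : PreForm k Φ V)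
    {ψ : Diff d M} (hψ : ψ ∈ H) {T : V →ₗ[ℝ] V}
    (hα : α.pullback (rightMap ψ) = α.act fun _ => T) :
    (dress u α).pullback (rightMap ψ) = (dress u α).act fun _ => T := by
  funext n p x
  have h : (p.map (rightMap ψ)).map (verticalMap u) =
      (p.map (verticalMap u)).map (rightMap ψ) :=
    Plot.ext fun z => verticalMap_rightAct_of_eq_conj (hu ψ hψ (p z))
  exact (congrArg (fun q => α q x) h).trans
    (congrArg (fun β : PreForm k Φ V => β (p.map (verticalMap u)) x) hα)

variable [IsManifold (𝓡 d) ∞ M]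

omit [SmoothRightAction d M Φ] in
theorem IsFundamental.mono {H K : Subgroup (Diff d M)} (hHK : H ≤ K) {n : ℕ} {q : Plot n Φ}
    {y w : Eu n} {X : VField d M} (h : IsFundamental H q y w X) : IsFundamental K q y w X := by
  obtain ⟨p, g, hp, hg, h⟩ := h
  exact ⟨p, g, hp, fun z => hHK (hg z), h⟩

omit [SmoothRightAction d M Φ] in
theorem IsHorizontal.mono {H K : Subgroup (Diff d M)} (hHK : H ≤ K) {α : PreForm k Φ V}
    (h : IsHorizontal K α) : IsHorizontal H α :=
  fun q y w X hX => h q y w X (hX.mono hHK)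

omit [SmoothRightAction d M Φ] in
theorem IsHorizontal.act {H : Subgroup (Diff d M)} {α : PreForm k Φ V} (h : IsHorizontal H α)
    (L : Φ → V →ₗ[ℝ] V) : IsHorizontal H (α.act L) := fun q y w X hX v i hi => by
  change L (q y) (α q y v) = 0
  rw [h q y w X hX v i hi, map_zero]

/-- In `q = p · g` the factor `g` is absorbed by `F_u`, so `F_u ∘ q = F_u ∘ p` does not vary along
`w`. No verticality axiom on `α` enters, so connections are covered too. -/
theorem isHorizontal_dress [DiffeologicalSpace V] {H : Subgroup (Diff d M)}
    {u : SmoothMap Φ (Diff d M)} (hu : ∀ ψ ∈ H, ∀ φ : Φ, u (φ <• ψ) = ψ⁻¹ * u φ)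
    {α : PreForm k Φ V} (hα : IsForm α) : IsHorizontal H (dress u α) := by
  rintro n q y w X ⟨p, g, hp, hg, -, hq, -⟩ v i hi
  refine hα.apply_eq_zero_of_invariant (q.map (verticalMap u)) (w := w) (fun z t => ?_) y v i hi
  have h : ∀ z, verticalMap u (q z) = verticalMap u (p z) := fun z => by
    rw [hq, verticalMap_rightAct_of_eq_inv_mul (hu _ (hg z) _)]
  change verticalMap u (q (z + t • w)) = verticalMap u (q z)
  rw [h, h, hp]

theorem isBasic_dress [DiffeologicalSpace V] {H : Subgroup (Diff d M)}
    {u : SmoothMap Φ (Diff d M)} (hu : ∀ ψ ∈ H, ∀ φ : Φ, u (φ <• ψ) = ψ⁻¹ * u φ)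
    {α : PreForm k Φ V} (hα : IsForm α) : IsBasic H (dress u α) :=
  ⟨hα.pullback _, isInvariant_dress hu α, isHorizontal_dress hu hα⟩

/-- Since `F_u` commutes with `H`, it carries `p · g` to `(F_u ∘ p) · g`: the same family `g`, hence
the same velocity. This gives the dressed connection its values on vertical vectors. -/
theorem IsFundamental.map_verticalMap {H : Subgroup (Diff d M)} {u : SmoothMap Φ (Diff d M)}
    (hu : ∀ ψ ∈ H, ∀ φ : Φ, u (φ <• ψ) = ψ⁻¹ * u φ * ψ) {n : ℕ} {q : Plot n Φ}
    {y w : Eu n} {X : VField d M} (h : IsFundamental H q y w X) :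
    IsFundamental H (q.map (verticalMap u)) y w X := by
  obtain ⟨p, g, hp, hg, h1, hq, hX⟩ := h
  refine ⟨p.map (verticalMap u), g, fun z t => congrArg (verticalMap u) (hp z t), hg, h1,
    fun z => ?_, hX⟩
  exact (congrArg (verticalMap u) (hq z)).trans (verticalMap_rightAct_of_eq_conj (hu _ (hg z) _))

theorem IsTensorial.dress_eq [DiffeologicalSpace V] {ρ : Representation ℝ (Diff d M) V}
    {α : PreForm k Φ V} (hα : IsTensorial ⊤ ρ α) (u : SmoothMap Φ (Diff d M)) :
    dress u α = α.act fun φ => ρ (u φ)⁻¹ :=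
  hα.pullback_verticalMap u fun _ => Subgroup.mem_top _

/-- No covariance of `u` is needed: the dressed form is pointwise a linear image of the horizontal
form `α`. -/
theorem IsTensorial.isHorizontal_dress [DiffeologicalSpace V] {ρ : Representation ℝ (Diff d M) V}
    {α : PreForm k Φ V} (hα : IsTensorial ⊤ ρ α) (u : SmoothMap Φ (Diff d M)) :
    IsHorizontal (⊤ : Subgroup (Diff d M)) (dress u α) := by
  rw [hα.dress_eq]
  exact IsHorizontal.act hα.horizontal _

theorem IsTensorial.dress [DiffeologicalSpace V] {ρ : Representation ℝ (Diff d M) V}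
    {α : PreForm k Φ V} (hα : IsTensorial ⊤ ρ α) {H : Subgroup (Diff d M)}
    {u : SmoothMap Φ (Diff d M)} (hu : ∀ ψ ∈ H, ∀ φ : Φ, u (φ <• ψ) = ψ⁻¹ * u φ * ψ) :
    IsTensorial H ρ (dress u α) where
  isForm := hα.isForm.pullback _
  equivariant ψ hψ := pullback_rightMap_dress hu α hψ (hα.equivariant ψ (Subgroup.mem_top ψ))
  horizontal := IsHorizontal.mono le_top (hα.isHorizontal_dress u)

theorem IsConnection.dress {conn : PreForm 1 Φ (VField d M)} (hc : IsConnection ⊤ conn)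
    {H : Subgroup (Diff d M)} {u : SmoothMap Φ (Diff d M)}
    (hu : ∀ ψ ∈ H, ∀ φ : Φ, u (φ <• ψ) = ψ⁻¹ * u φ * ψ) : IsConnection H (dress u conn) where
  isForm := hc.isForm.pullback _
  vertical _ y w X hX := hc.vertical _ y w X ((hX.map_verticalMap hu).mono le_top)
  equivariant ψ hψ := pullback_rightMap_dress hu conn hψ (hc.equivariant ψ (Subgroup.mem_top ψ))

end Dressing

end FieldSpace

theorem proposition1
    {d : ℕ} {M : Type*} [TopologicalSpace M] [ChartedSpace (Eu d) M] [IsManifold (𝓡 d) ∞ M]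
    {Φ : Type*} [DiffeologicalSpace Φ] [MulAction (Diff d M)ᵐᵒᵖ Φ] [SmoothRightAction d M Φ]
    {V : Type*} [AddCommGroup V] [Module ℝ V] [DiffeologicalSpace V]
    (ρ : Representation ℝ (Diff d M) V)
    (Diff₀ : Subgroup (Diff d M)) [Diff₀.Normal]
    (s : Diff d M ⧸ Diff₀ →* Diff d M) (hs : ∀ ψ, (s ψ : Diff d M ⧸ Diff₀) = ψ)
    (u : SmoothMap Φ (Diff d M))
    (hu₀ : ∀ ψ ∈ Diff₀, ∀ φ : Φ, u (φ <• ψ) = ψ⁻¹ * u φ)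
    (hu : ∀ (ψ : Diff d M ⧸ Diff₀) (φ : Φ), u (φ <• s ψ) = (s ψ)⁻¹ * u φ * s ψ) :
    (∀ (k : ℕ) (α : PreForm k Φ V), IsTensorial ⊤ ρ α →
      dress u α = α.act (fun φ => ρ (u φ)⁻¹) ∧
      IsBasic Diff₀ (dress u α) ∧
      IsHorizontal (⊤ : Subgroup (Diff d M)) (dress u α) ∧
      IsTensorial s.range ρ (dress u α) ∧
      ∀ ψ : SmoothMap Φ (Diff d M), (∀ φ, ψ φ ∈ s.range) →
        (dress u α).pullback (verticalMap ψ) = (dress u α).act fun φ => ρ (ψ φ)⁻¹) ∧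
    (∀ conn : PreForm 1 Φ (VField d M), IsConnection ⊤ conn →
      dress u conn = conn.act (fun φ => conjLin (u φ)) + maurerCartan u ∧
      IsBasic Diff₀ (dress u conn) ∧
      IsConnection s.range (dress u conn) ∧
      ∀ ψ : SmoothMap Φ (Diff d M), (∀ φ, ψ φ ∈ s.range) →
        (dress u conn).pullback (verticalMap ψ) =
          (dress u conn).act (fun φ => conjLin (ψ φ)) + maurerCartan ψ) := by
  have hu' : ∀ ψ ∈ s.range, ∀ φ : Φ, u (φ <• ψ) = ψ⁻¹ * u φ * ψ := by
    rintro _ ⟨ψ, rfl⟩ φ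
    exact hu ψ φ
  refine ⟨fun k α hα => ?_, fun conn hc => ?_⟩
  · exact ⟨hα.dress_eq u, isBasic_dress hu₀ hα.isForm, hα.isHorizontal_dress u, hα.dress hu',
      fun ψ hψ => (hα.dress hu').pullback_verticalMap ψ hψ⟩
  · exact ⟨hc.pullback_verticalMap u fun _ => Subgroup.mem_top _, isBasic_dress hu₀ hc.isForm,
      hc.dress hu', fun ψ hψ => (hc.dress hu').pullback_verticalMap ψ hψ⟩
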